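/- Let $\mathcal H=(V,E)$ be a connected hypergraph: $V$ is a finite set, $E$ is a finite multiset of nonempty subsets of $V$, and the bipartite graph $\mathrm{Bip}\,\mathcal H$ with node classes $V$ and $E$ (where $v\in V$ and $e\in E$ are adjacent iff $v\in e$) is connected. A ribbon structure on $\mathrm{Bip}\,\mathcal H$ is a choice, for each node $x$, of a cyclic permutation of the edges at $x$; $xy^+$ and $xy^-$ denote the edges following and preceding $xy$ at $x$. Subgraphs $G$ inherit ribbon structures by restricting the cyclic orders (we then write $xy_G^+$), and the reversed ribbon structure has all cyclic orders inverted. Fix a ribbon structure, a base node $b_0\in V\cup E$ and a base edge $b_0b_1$. Let $\{A,B\}=\{V,E\}$. A hypertree on $A$ in a graph $G$ with node set $V\cup E$ is a vector $\mathbf f\colon A\to\mathbb Z_{\ge 0}$ such that some spanning tree $T$ of $G$ has degree $d_T(a)=\mathbf f(a)+1$ at each $a\in A$. For a spanning tree $T$ of $\mathrm{Bip}\,\mathcal H$ let $\mathbf f_V(T)(v)=d_T(v)-1$ for $v\in V$; this is a hypertree on $V$. The (ht:$A$, cut:$B$) Bernardi process on a hypertree $\mathbf f$ on $A$ maintains a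 current graph, initially $\mathrm{Bip}\,\mathcal H$, and a current edge. If $b_0\in B$, the initial current edge is $b_0b_1$; if $b_0\in A$, the edge $b_0b_1$ counts as traversed from the direction of $b_0$ and the initial current edge is $b_1b_0^+$. At each step let $G$ be the current graph and $ba$ the current edge, where $b\in B$ and $a\in A$. If $\mathbf f$ is a hypertree on $A$ in $G-ba$, then the next current graph is $G-ba$ and the next current edge is $ba_G^+$. Otherwise the current graph remains $G$, the edge $ba$ is traversed from the direction of $b$, then the edge $ac=ab_G^+$ is traversed from the direction of $a$, and the next current edge is $ca_G^+$. The process stops right before an edge would be traversed for the second time from the same direction. It yields $T$ if it stops with current graph $T$. **Theorem.** For every hypertree $\mathbf f$ on $E$, the (ht:$E$, cut:$V$) Bernardi process on $\mathbf f$, with the fixed ribbon structure, base node $b_0$ and base edge $b_0b_1$, stops and yields a spanning tree $T$ of $\mathrm{Bip}\,\mathcal H$; and the (ht:$V$, cut:$E$) Bernardi process on $\mathbf f_V(T)$, with the reversed ribbon structure, base node $b_0$ and base edge $b_0b_1^-$ (the edge preceding $b_0b_1$ at $b_0$ in the original ribbon structure), also stops and yields $T$. -/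

import Mathlib

namespace Bernardi

universe u v w

/-- A finite multiset of nonempty subsets (hyperedges) of `V`, presented as a family indexed by `E`;
repeated hyperedges are allowed. -/
structure MultiHypergraph (V : Type u) (E : Type v) where
  verts : E → Finset V
  verts_nonempty : ∀ e, (verts e).Nonempty

/-- The underlying bipartite graph: a violet node `Sum.inl v` is joined to an emerald node
`Sum.inr e` exactly when `v` belongs to the hyperedge `e`. -/
def MultiHypergraph.bip {V : Type u} {E : Type v} (H : MultiHypergraph V E) :
    SimpleGraph (V ⊕ E) where
  Adj x y := (∃ v e, v ∈ H.verts e ∧ x = Sum.inl v ∧ y = Sum.inr e) ∨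
    (∃ v e, v ∈ H.verts e ∧ x = Sum.inr e ∧ y = Sum.inl v)
  symm := ⟨by
    rintro x y (⟨v, e, h, rfl, rfl⟩ | ⟨v, e, h, rfl, rfl⟩)
    · exact Or.inr ⟨v, e, h, rfl, rfl⟩
    · exact Or.inl ⟨v, e, h, rfl, rfl⟩⟩
  loopless := ⟨by
    rintro x (⟨v, e, -, rfl, h⟩ | ⟨v, e, -, rfl, h⟩) <;> cases h⟩

/-- A ribbon structure on a simple graph: at every node `x` a cyclic permutation of the edges at `x`.
The edge `xy` is represented by its other endpoint `y`, so `rot x y = z` means `xy⁺ = xz`.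
Nodes that are not neighbours of `x` are fixed by `rot x`. -/
structure RibbonStructure {N : Type u} (G : SimpleGraph N) where
  rot : N → Equiv.Perm N
  isCycleOn : ∀ x, (rot x).IsCycleOn (G.neighborSet x)
  rot_eq_self : ∀ x y, ¬ G.Adj x y → rot x y = y

/-- The reversed ribbon structure: all cyclic orders are turned opposite. -/
def RibbonStructure.reverse {N : Type u} {G : SimpleGraph N} (ρ : RibbonStructure G) :
    RibbonStructure G where
  rot x := (ρ.rot x)⁻¹
  isCycleOn x := (ρ.isCycleOn x).inv
  rot_eq_self x y h := by
    rw [Equiv.Perm.inv_eq_iff_eq]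
    exact (ρ.rot_eq_self x y h).symm

/-- The edge `xy⁻` preceding `xy` at `x`, again represented by its endpoint other than `x`. -/
def RibbonStructure.prev {N : Type u} {G : SimpleGraph N} (ρ : RibbonStructure G) (x y : N) : N :=
  (ρ.rot x).symm y

/-- The edge following `xy` at `x` in the subgraph `K` with the restricted cyclic orders: the first
edge of `K` met when turning around `x` from `xy`. -/
noncomputable def RibbonStructure.nextIn {N : Type u} {G : SimpleGraph N} (ρ : RibbonStructure G)
    (K : SimpleGraph N) (x y : N) : N :=
  ((ρ.rot x) ^ sInf {k : ℕ | 0 < k ∧ K.Adj x (((ρ.rot x) ^ k) y)}) y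

/-- `T` is a spanning tree of `G`. -/
def IsSpanningTree {N : Type u} (G T : SimpleGraph N) : Prop :=
  T ≤ G ∧ T.IsTree

/-- `f` is a hypertree of `G` on the class of nodes `ι a`: some spanning tree of `G` has degree
`f a + 1` at every `ι a`. -/
def IsHypertree {N : Type u} {A : Type w} (G : SimpleGraph N) (ι : A → N) (f : A → ℕ) : Prop :=
  ∃ T : SimpleGraph N, IsSpanningTree G T ∧ ∀ a, (T.neighborSet (ι a)).ncard = f a + 1

/-- The vector of `T`-degrees minus one on the nodes `ι a`. -/
noncomputable def induced {N : Type u} {A : Type w} (ι : A → N) (T : SimpleGraph N) : A → ℕ :=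
  fun a => (T.neighborSet (ι a)).ncard - 1

/-- A moment of the walk: the current graph, the current edge given by its endpoint `node` at which
cutting is allowed and its other endpoint `nbr`, and the set of pairs `(x, y)` such that the edge
`xy` has been traversed from the direction of `x`. -/
structure WalkState (N : Type u) where
  graph : SimpleGraph N
  node : N
  nbr : N
  traversed : Set (N × N)

open Classical in
/-- The state at the beginning. The nodes at which cutting is allowed are those of `cut`. -/
noncomputable def initState {N : Type u} {G : SimpleGraph N} (ρ : RibbonStructure G)
    (cut : Set N) (b₀ b₁ : N) : WalkState N :=
  if b₀ ∈ cut then ⟨G, b₀, b₁, ∅⟩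
  else ⟨G, b₁, ρ.nextIn G b₁ b₀, {(b₀, b₁)}⟩

open Classical in
/-- One step on the hypertree `f` (given on the nodes `ι a`). If `f` is still a hypertree without
the current edge, the edge is removed. Otherwise it is traversed, and then so is the edge following
it at its other endpoint. The value `none` means that the walk stops, because one of these two
edges would be traversed for the second time from the same direction. -/
noncomputable def step {N : Type u} {A : Type w} {G : SimpleGraph N} (ρ : RibbonStructure G)
    (ι : A → N) (f : A → ℕ) (s : WalkState N) : Option (WalkState N) :=
  if IsHypertree (s.graph.deleteEdges {s(s.node, s.nbr)}) ι f then
    some ⟨s.graph.deleteEdges {s(s.node, s.nbr)}, s.node,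
      ρ.nextIn s.graph s.node s.nbr, s.traversed⟩
  else if (s.node, s.nbr) ∈ s.traversed ∨
      (s.nbr, ρ.nextIn s.graph s.nbr s.node) ∈ s.traversed then
    none
  else
    some ⟨s.graph, ρ.nextIn s.graph s.nbr s.node,
      ρ.nextIn s.graph (ρ.nextIn s.graph s.nbr s.node) s.nbr,
      s.traversed ∪ {(s.node, s.nbr), (s.nbr, ρ.nextIn s.graph s.nbr s.node)}⟩

/-- The walk, cutting at nodes of `cut` and run on `f`, stops after finitely many steps, and `T` is
the current graph when it stops. -/
def Yields {N : Type u} {A : Type w} {G : SimpleGraph N} (ρ : RibbonStructure G)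
    (ι : A → N) (cut : Set N) (b₀ b₁ : N) (f : A → ℕ) (T : SimpleGraph N) : Prop :=
  ∃ s : WalkState N,
    Relation.ReflTransGen (fun a b => step ρ ι f a = some b) (initState ρ cut b₀ b₁) s ∧
      step ρ ι f s = none ∧ s.graph = T

/-- The (ht:`E`, cut:`V`) Bernardi walk on `f` yields `T`. -/
def YieldsHtECutV {V : Type u} {E : Type v} {H : MultiHypergraph V E}
    (ρ : RibbonStructure H.bip) (b₀ b₁ : V ⊕ E) (f : E → ℕ) (T : SimpleGraph (V ⊕ E)) : Prop :=
  Yields ρ Sum.inr (Set.range Sum.inl) b₀ b₁ f T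

/-- The (ht:`V`, cut:`E`) Bernardi walk on `g` yields `T`. -/
def YieldsHtVCutE {V : Type u} {E : Type v} {H : MultiHypergraph V E}
    (ρ : RibbonStructure H.bip) (b₀ b₁ : V ⊕ E) (g : V → ℕ) (T : SimpleGraph (V ⊕ E)) : Prop :=
  Yields ρ Sum.inl (Set.range Sum.inr) b₀ b₁ g T

end Bernardi

/-! The proof describes the output of the process by a condition that is visibly symmetric under
reversal. The tour around a spanning tree `T` permutes the darts of the graph: tree edges are
traversed, other edges are skipped, and all darts form one cycle (`isCycleOn_tour`). Cut it open at
the base dart. Then `T` is a Jaeger tree for `B` if each non-tree edge is first met at its endpoint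
in `B`.

Three facts suffice. Every hypertree off `B` is realised by a Jaeger tree (`exists_isJaeger`): among
the spanning trees with the given degrees off `B`, take one whose tour has lexicographically
greatest `record`; a violation of the Jaeger condition allows an edge exchange that raises the
record.

The process cutting at `B`, run on the degrees of a Jaeger tree `T`, follows the tour of `T` and
ends with `T` (`IsJaeger.yields`). Non-tree edges are cut, since `T` survives their removal. Tree
edges are kept: without one, the degrees off `B` would force too many edges into one side of its
fundamental cut (`IsJaeger.not_realizable`).

Reversal of the ribbon structure, with the base edge moved one place back, runs through the non-tree
darts in the opposite order. What was met first in `B` is now met first off `B`, so the same `T` is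
a Jaeger tree for the complement (`IsJaeger.reverse`) and the second process yields it too. Since
the process is deterministic, this covers whatever the first process yields. -/

namespace Bernardi

open SimpleGraph Equiv

universe u w

variable {N : Type u} {G : SimpleGraph N}

/-! ### Fundamental cuts of a tree and a degree count -/

/-- `S` is the set of nodes on the side of `y` when the edge `yx` of `T` is removed. -/
structure IsCut (T : SimpleGraph N) (S : Set N) (y x : N) : Prop where
  mem : y ∈ S
  not_mem : x ∉ S
  adj : T.Adj y x
  eq_of_adj : ∀ u v, u ∈ S → v ∉ S → T.Adj u v → u = y ∧ v = x

theorem IsCut.compl {T : SimpleGraph N} {S : Set N} {y x : N} (h : IsCut T S y x) :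
    IsCut T Sᶜ x y where
  mem := h.not_mem
  not_mem := fun h' => h' h.mem
  adj := h.adj.symm
  eq_of_adj u v hu hv huv := (h.eq_of_adj v u (not_not.mp hv) hu huv.symm).symm

/-- The side of `y` when the edge `yx` of `T` is removed. -/
def side (T : SimpleGraph N) (y x : N) : Set N :=
  {z | (T.deleteEdges {s(y, x)}).Reachable y z}

theorem isCut_side {T : SimpleGraph N} (hT : T.IsAcyclic) {y x : N} (h : T.Adj y x) :
    IsCut T (side T y x) y x where
  mem := Reachable.refl _
  not_mem := isBridge_iff.mp (isAcyclic_iff_forall_adj_isBridge.mp hT h)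
  adj := h
  eq_of_adj u v hu hv huv := by
    by_contra hne
    by_cases hs : s(u, v) = s(y, x)
    · rcases Sym2.eq_iff.mp hs with h' | ⟨h1, h2⟩
      · exact hne h'
      · exact hv (h2 ▸ Reachable.refl _)
    · exact hv (hu.trans (Adj.reachable (by simpa [deleteEdges_adj] using ⟨huv, by simpa using hs⟩)))

/-- In a tree, the first edge of the path from `a` to `b`. -/
theorem exists_isCut_of_ne {T : SimpleGraph N} (hT : T.IsTree) {a b : N} (hab : a ≠ b) :
    ∃ (S : Set N) (c : N), IsCut T S c a ∧ b ∈ S := by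
  obtain ⟨p, hp⟩ := (hT.connected a b).exists_isPath
  cases p with
  | nil => exact absurd rfl hab
  | @cons _ c _ h q =>
    refine ⟨side T c a, c, isCut_side hT.isAcyclic h.symm, ?_⟩
    have hq := (Walk.cons_isPath_iff h q).mp hp
    have : ∀ e ∈ q.edges, e ∉ ({s(c, a)} : Set (Sym2 N)) := by
      rintro e he rfl
      exact hq.2 (q.snd_mem_support_of_mem_edges he)
    exact ⟨q.toDeleteEdges _ this⟩

/-- A path from a node of `S` to `y` cannot leave `S`: it could do so only through `y`, which is its
end. -/
theorem IsCut.connected_induce {T : SimpleGraph N} {S : Set N} {y x : N} (h : IsCut T S y x)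
    (hT : T.Connected) : (T.induce S).Connected := by
  have key : ∀ (u v : N) (p : T.Walk u v), p.IsPath → ∀ (hu : u ∈ S) (hv : v ∈ S), v = y →
      (T.induce S).Reachable ⟨u, hu⟩ ⟨v, hv⟩ := by
    intro u v p
    induction p with
    | nil => intros; exact Reachable.refl _
    | @cons u w v huw q ih =>
      intro hp hu hv hvy
      have hq := (Walk.cons_isPath_iff huw q).mp hp
      by_cases hw : w ∈ S
      · have : (T.induce S).Adj ⟨u, hu⟩ ⟨w, hw⟩ := huw
        exact this.reachable.trans (ih hq.1 hw hv hvy)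
      · have := (h.eq_of_adj u w hu hw huw).1
        subst hvy
        exact absurd (this ▸ q.end_mem_support) hq.2
  rw [connected_iff_exists_forall_reachable]
  refine ⟨⟨y, h.mem⟩, fun ⟨u, hu⟩ => ?_⟩
  obtain ⟨p, hp⟩ := (hT u y).exists_isPath
  exact (key u y p hp hu h.mem rfl).symm

theorem ncard_edgeSet_lt_of_isAcyclic [Finite N] [Nonempty N] {F : SimpleGraph N}
    (hF : F.IsAcyclic) : F.edgeSet.ncard < Nat.card N := by
  classical
  obtain ⟨T, hFT, -, hT⟩ := (connected_top (V := N)).exists_isTree_le_of_le_of_isAcyclic le_top hF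
  have h1 := (isTree_iff_connected_and_card.mp hT).2
  have h2 : F.edgeSet.ncard ≤ T.edgeSet.ncard :=
    Set.ncard_le_ncard (edgeSet_mono hFT) (Set.toFinite _)
  rw [Nat.card_coe_set_eq] at h1
  omega

theorem ncard_edgeSet_of_isTree [Finite N] {T : SimpleGraph N}
    (hT : T.IsTree) : T.edgeSet.ncard + 1 = Nat.card N := by
  rw [← (isTree_iff_connected_and_card.mp hT).2, Nat.card_coe_set_eq]

/-- Every edge of `G` joins a node of `B` to a node outside `B`. -/
def Bipartitioned (G : SimpleGraph N) (B : Set N) : Prop :=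
  ∀ x y, G.Adj x y → (x ∈ B ↔ y ∉ B)

theorem Bipartitioned.compl {G : SimpleGraph N} {B : Set N} (h : Bipartitioned G B) :
    Bipartitioned G Bᶜ := fun x y hxy => by
  have := h x y hxy
  simp only [Set.mem_compl_iff]
  tauto

theorem Bipartitioned.mono {G K : SimpleGraph N} {B : Set N} (h : Bipartitioned G B) (hK : K ≤ G) :
    Bipartitioned K B := fun x y hxy => h x y (hK hxy)

open Classical in
theorem Bipartitioned.sum_ncard [Fintype N] {G : SimpleGraph N} {B : Set N}
    (h : Bipartitioned G B) :
    ∑ z : N with z ∉ B, (G.neighborSet z).ncard = G.edgeSet.ncard := by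
  have hb : G.IsBipartiteWith ((Finset.univ.filter (· ∉ B) : Finset N) : Set N)
      ((Finset.univ.filter (· ∈ B) : Finset N) : Set N) := by
    constructor
    · rw [Finset.disjoint_coe, Finset.disjoint_left]
      simp
    · intro v w hvw
      have := h v w hvw
      simp only [Finset.coe_filter, Finset.mem_univ, true_and, Set.mem_ofPred_eq]
      tauto
  have := isBipartiteWith_sum_degrees_eq_card_edges hb
  rw [← coe_edgeFinset, Set.ncard_coe_finset, ← this]
  refine Finset.sum_congr rfl fun z _ => ?_
  rw [← card_neighborSet_eq_degree, ← Nat.card_eq_fintype_card, Nat.card_coe_set_eq]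

/-- A cut argument: the degrees of a tree `T` off `B` cannot be realised by a forest which has no
edge from a node of `S` off `B` to the complement of `S`. -/
theorem IsCut.false_of_ncard_eq [Finite N] {T T' : SimpleGraph N} {B S : Set N} {y x : N}
    (h : IsCut T S y x) (hT : T.IsTree) (hT' : T'.IsAcyclic) (hB : Bipartitioned T B)
    (hB' : Bipartitioned T' B) (hy : y ∉ B)
    (hdeg : ∀ z ∉ B, (T'.neighborSet z).ncard = (T.neighborSet z).ncard)
    (hS : ∀ u v, u ∈ S → u ∉ B → T'.Adj u v → v ∈ S) : False := by
  classical
  have := Fintype.ofFinite N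
  have : Nonempty S := ⟨⟨y, h.mem⟩⟩
  have e1 := ncard_edgeSet_lt_of_isAcyclic (hT'.induce S)
  have e2 := ncard_edgeSet_of_isTree
    (⟨h.connected_induce hT.connected, hT.isAcyclic.induce S⟩ : (T.induce S).IsTree)
  have b1 : Bipartitioned (T'.induce S) (Subtype.val ⁻¹' B) := fun x y hxy => hB' _ _ hxy
  have b2 : Bipartitioned (T.induce S) (Subtype.val ⁻¹' B) := fun x y hxy => hB _ _ hxy
  rw [← b1.sum_ncard] at e1
  rw [← b2.sum_ncard] at e2
  have img : ∀ (F : SimpleGraph N) (z : S),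
      ((F.induce S).neighborSet z).ncard = (F.neighborSet z ∩ S).ncard := by
    intro F z
    rw [← Set.ncard_image_of_injective _ Subtype.val_injective]
    congr 1
    ext w
    simp
  -- Inside `S` no degree of `T'` off `B` is lost, while `T` loses the edge `yx` at `y`; so the
  -- forest induced by `T'` would have at least as many edges as `S` has nodes.
  have lt : ∑ z : S with z ∉ (Subtype.val ⁻¹' B : Set S), ((T.induce S).neighborSet z).ncard <
      ∑ z : S with z ∉ (Subtype.val ⁻¹' B : Set S), ((T'.induce S).neighborSet z).ncard := by
    have hle : ∀ z : S, z ∉ (Subtype.val ⁻¹' B : Set S) →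
        ((T'.induce S).neighborSet z).ncard = (T.neighborSet z).ncard := by
      intro z hz
      have hsub : T'.neighborSet z ⊆ S := fun w hw => hS z w z.2 hz hw
      rw [img, ← hdeg z hz, Set.inter_eq_left.mpr hsub]
    refine Finset.sum_lt_sum (fun z hz => ?_) ⟨⟨y, h.mem⟩, by simpa using hy, ?_⟩
    · rw [hle z (by simpa using hz), img]
      exact Set.ncard_le_ncard Set.inter_subset_left (Set.toFinite _)
    · rw [hle _ hy, img]
      refine Set.ncard_lt_ncard ⟨Set.inter_subset_left, fun hsub => ?_⟩ (Set.toFinite _)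
      exact h.not_mem (hsub (show x ∈ T.neighborSet y from h.adj)).2
  omega

/-! ### Edge exchange -/

/-- The exchange of the edge `ac` for the edge `ab`. -/
def exchange (T : SimpleGraph N) (a c b : N) : SimpleGraph N :=
  T.deleteEdges {s(a, c)} ⊔ edge a b

theorem exchange_adj {T : SimpleGraph N} {a c b u v : N} (hab : a ≠ b) :
    (exchange T a c b).Adj u v ↔ (T.Adj u v ∧ s(u, v) ≠ s(a, c)) ∨ s(u, v) = s(a, b) := by
  simp only [exchange, sup_adj, deleteEdges_adj, edge_adj, Set.mem_singleton_iff, Sym2.eq_iff]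
  grind

theorem ncard_neighborSet_exchange [Finite N] {T : SimpleGraph N} {B : Set N} {a b c : N}
    (ha : a ∉ B) (hb : b ∈ B) (hc : c ∈ B) (hac : T.Adj a c) (hnab : ¬ T.Adj a b) {z : N}
    (hz : z ∉ B) : ((exchange T a c b).neighborSet z).ncard = (T.neighborSet z).ncard := by
  have hab : a ≠ b := fun e => ha (e ▸ hb)
  have hzb : z ≠ b := fun e => hz (e ▸ hb)
  have hzc : z ≠ c := fun e => hz (e ▸ hc)
  by_cases hza : z = a
  · subst hza
    have : (exchange T z c b).neighborSet z = insert b (T.neighborSet z \ {c}) := by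
      ext w
      simp only [mem_neighborSet, exchange_adj hab, Set.mem_insert_iff, Set.mem_sdiff,
        Set.mem_singleton_iff, Sym2.eq_iff]
      grind
    rw [this, Set.ncard_insert_of_notMem (fun h => hnab h.1) (Set.toFinite _),
      Set.ncard_sdiff_singleton_add_one (show c ∈ T.neighborSet z from hac) (Set.toFinite _)]
  · congr 1
    ext w
    simp only [mem_neighborSet, exchange_adj hab, Sym2.eq_iff]
    grind

/-- Deleting `ac` leaves two connected sides; `a` and `b` lie on different ones, so the new edge
reconnects them and closes no cycle. -/
theorem IsCut.isTree_exchange [Finite N] {T : SimpleGraph N} {S : Set N} {a b c : N}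
    (h : IsCut T S c a) (hT : T.IsTree) (hb : b ∈ S) : (exchange T a c b).IsTree := by
  have hab : a ≠ b := fun e => h.not_mem (e ▸ hb)
  refine ⟨?_, ?_⟩
  · have inside : ∀ {S' : Set N} {y x : N}, IsCut T S' y x → s(y, x) = s(a, c) →
        ∀ u v, u ∈ S' → v ∈ S' → (exchange T a c b).Reachable u v := by
      intro S' y x h' e u v hu hv
      have hr := (h'.connected_induce hT.connected) ⟨u, hu⟩ ⟨v, hv⟩
      refine hr.map (G' := exchange T a c b) ⟨Subtype.val, ?_⟩
      rintro ⟨p, hp⟩ ⟨q, hq⟩ hpq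
      rw [exchange_adj hab]
      refine Or.inl ⟨hpq, fun e' => ?_⟩
      rw [← e] at e'
      rcases Sym2.eq_iff.mp e' with ⟨h1, h2⟩ | ⟨h1, h2⟩
      · exact h'.not_mem (h2 ▸ hq)
      · exact h'.not_mem (h1 ▸ hp)
    have hab' : (exchange T a c b).Adj a b := (exchange_adj hab).mpr (Or.inr rfl)
    rw [connected_iff_exists_forall_reachable]
    refine ⟨a, fun u => ?_⟩
    by_cases hu : u ∈ S
    · exact hab'.reachable.trans (inside h Sym2.eq_swap b u hb hu)
    · exact inside h.compl rfl a u h.not_mem hu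
  · refine IsAcyclic.sup_edge_of_not_reachable ?_ (hT.isAcyclic.anti (deleteEdges_le _))
    intro hr
    obtain ⟨p⟩ := hr
    obtain ⟨d, hd, h1, h2⟩ := p.exists_boundary_dart Sᶜ h.not_mem (not_not.mpr hb)
    have hadj := d.adj
    rw [deleteEdges_adj] at hadj
    have := h.compl.eq_of_adj _ _ h1 h2 hadj.1
    exact hadj.2 (by simp [this.1, this.2])

/-! ### The tour around a spanning tree -/

open Classical in
/-- The reversal of the darts of `T`, as a permutation of all pairs of nodes. -/
noncomputable def flip (T : SimpleGraph N) : Perm (N × N) :=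
  Function.Involutive.toPerm (fun p => if T.Adj p.1 p.2 then p.swap else p) fun p => by
    by_cases h : T.Adj p.1 p.2
    · simp [h, h.symm]
    · simp [h]

theorem flip_of_adj {T : SimpleGraph N} {x y : N} (h : T.Adj x y) : flip T (x, y) = (y, x) :=
  if_pos h

theorem flip_of_not_adj {T : SimpleGraph N} {p : N × N} (h : ¬ T.Adj p.1 p.2) : flip T p = p :=
  if_neg h

theorem flip_mul_flip (T : SimpleGraph N) : flip T * flip T = 1 :=
  Equiv.ext fun p => (flip T).left_inv p

theorem flip_flip (T : SimpleGraph N) (p : N × N) : flip T (flip T p) = p := (flip T).left_inv p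

/-- The rotation of darts around their first node. -/
def RibbonStructure.turn (ρ : RibbonStructure G) : Perm (N × N) :=
  Equiv.prodShear (Equiv.refl N) ρ.rot

theorem RibbonStructure.turn_apply (ρ : RibbonStructure G) (x y : N) :
    ρ.turn (x, y) = (x, ρ.rot x y) := rfl

theorem RibbonStructure.turn_reverse (ρ : RibbonStructure G) : ρ.reverse.turn = ρ.turn⁻¹ := by
  rw [eq_inv_iff_mul_eq_one]
  ext p <;> simp [Equiv.Perm.mul_apply, RibbonStructure.turn, RibbonStructure.reverse]

/-- The tour around `T`: edges of `T` are traversed, other edges are skipped. -/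
noncomputable def RibbonStructure.tour (ρ : RibbonStructure G) (T : SimpleGraph N) :
    Perm (N × N) :=
  ρ.turn * flip T

theorem RibbonStructure.tour_of_adj (ρ : RibbonStructure G) {T : SimpleGraph N} {x y : N}
    (h : T.Adj x y) : ρ.tour T (x, y) = (y, ρ.rot y x) := by
  rw [tour, Perm.mul_apply, flip_of_adj h, turn_apply]

theorem RibbonStructure.tour_of_not_adj (ρ : RibbonStructure G) {T : SimpleGraph N} {x y : N}
    (h : ¬ T.Adj x y) : ρ.tour T (x, y) = (x, ρ.rot x y) := by
  rw [tour, Perm.mul_apply, flip_of_not_adj h, turn_apply]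

theorem RibbonStructure.tour_eq (ρ : RibbonStructure G) {T T' : SimpleGraph N} {p : N × N}
    (h : T.Adj p.1 p.2 ↔ T'.Adj p.1 p.2) : ρ.tour T p = ρ.tour T' p := by
  obtain ⟨x, y⟩ := p
  by_cases hT : T.Adj x y
  · rw [ρ.tour_of_adj hT, ρ.tour_of_adj (h.mp hT)]
  · rw [ρ.tour_of_not_adj hT, ρ.tour_of_not_adj (mt h.mpr hT)]

/-- The pairs of adjacent nodes. -/
def darts (G : SimpleGraph N) : Set (N × N) := {p | G.Adj p.1 p.2}

theorem RibbonStructure.adj_rot (ρ : RibbonStructure G) {x y : N} :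
    G.Adj x (ρ.rot x y) ↔ G.Adj x y :=
  (ρ.isCycleOn x).apply_mem_iff (x := y)

theorem RibbonStructure.tour_mem_darts (ρ : RibbonStructure G) {T : SimpleGraph N} (hT : T ≤ G)
    {p : N × N} (hp : p ∈ darts G) : ρ.tour T p ∈ darts G := by
  obtain ⟨x, y⟩ := p
  by_cases h : T.Adj x y
  · rw [ρ.tour_of_adj h]
    exact ρ.adj_rot.mpr (hT h.symm)
  · rw [ρ.tour_of_not_adj h]
    exact ρ.adj_rot.mpr hp

theorem RibbonStructure.tour_pow_mem_darts (ρ : RibbonStructure G) {T : SimpleGraph N}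
    (hT : T ≤ G) {p : N × N} (hp : p ∈ darts G) (n : ℕ) : (ρ.tour T ^ n) p ∈ darts G := by
  induction n with
  | zero => exact hp
  | succ n ih => rw [pow_succ', Perm.mul_apply]; exact ρ.tour_mem_darts hT ih

/-- A tour that is on one side of a tree edge stays there until it arrives at that edge. -/
theorem IsCut.tour_stays (ρ : RibbonStructure G) {T : SimpleGraph N} {S : Set N} {y x : N}
    (h : IsCut T S y x) (s : N × N) {i j : ℕ} (hij : i ≤ j) (hi : ((ρ.tour T ^ i) s).1 ∈ S)
    (hne : ∀ k, i ≤ k → k < j → (ρ.tour T ^ k) s ≠ (y, x)) : ((ρ.tour T ^ j) s).1 ∈ S := by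
  induction j, hij using Nat.le_induction with
  | base => exact hi
  | succ j hij ih =>
    have hj := ih fun k h1 h2 => hne k h1 (by omega)
    have hjne := hne j hij (by omega)
    rw [pow_succ', Perm.mul_apply]
    obtain ⟨⟨u, v⟩, hp⟩ : ∃ q, (ρ.tour T ^ j) s = q := ⟨_, rfl⟩
    rw [hp] at hj hjne ⊢
    by_cases huv : T.Adj u v
    · rw [ρ.tour_of_adj huv]
      by_contra hv
      obtain ⟨rfl, rfl⟩ := h.eq_of_adj u v hj hv huv
      exact hjne rfl
    · rw [ρ.tour_of_not_adj huv]
      exact hj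

/-- Once the tour crosses a tree edge it must cross back, or it would stay on the far side and never
return to its starting dart. The step after crossing back is the rotation of that dart, so tour
orbits are closed under rotation. -/
theorem RibbonStructure.sameCycle_turn [Finite N] (ρ : RibbonStructure G) {T : SimpleGraph N}
    (hT : T.IsAcyclic) (p : N × N) : (ρ.tour T).SameCycle p (ρ.turn p) := by
  obtain ⟨x, y⟩ := p
  by_cases h : T.Adj x y
  swap
  · refine ⟨1, ?_⟩
    rw [zpow_one, ρ.tour_of_not_adj h, turn_apply]
  have hcut := isCut_side hT h.symm
  have key : ∃ k, 1 ≤ k ∧ (ρ.tour T ^ k) (x, y) = (y, x) := by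
    by_contra! hne
    have := hcut.tour_stays ρ (x, y) (i := 1) (j := orderOf (ρ.tour T)) (orderOf_pos _)
      (by rw [pow_one, ρ.tour_of_adj h]; exact hcut.mem) fun k h1 _ => hne k h1
    rw [pow_orderOf_eq_one] at this
    exact hcut.not_mem this
  obtain ⟨k, -, hk⟩ := key
  refine ⟨(k + 1 : ℕ), ?_⟩
  rw [zpow_natCast, pow_succ', Perm.mul_apply, hk, ρ.tour_of_adj h.symm, turn_apply]

/-- The tour around a spanning tree is a single cycle. -/
theorem RibbonStructure.isCycleOn_tour [Finite N] (ρ : RibbonStructure G) {T : SimpleGraph N}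
    (hT : IsSpanningTree G T) : (ρ.tour T).IsCycleOn (darts G) := by
  refine ⟨⟨fun p hp => ρ.tour_mem_darts hT.1 hp, (ρ.tour T).injective.injOn, ?_⟩, ?_⟩
  · intro p hp
    refine ⟨(ρ.tour T ^ (orderOf (ρ.tour T) - 1)) p, ρ.tour_pow_mem_darts hT.1 hp _, ?_⟩
    rw [← Perm.mul_apply, ← pow_succ', Nat.sub_add_cancel (orderOf_pos _), pow_orderOf_eq_one]
    rfl
  have hturn := ρ.sameCycle_turn hT.2.isAcyclic
  have hpow : ∀ x y (n : ℕ), (ρ.tour T).SameCycle (x, y) (x, (ρ.rot x ^ n) y) := by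
    intro x y n
    induction n with
    | zero => exact Perm.SameCycle.refl _ _
    | succ n ih =>
      rw [pow_succ', Perm.mul_apply]
      exact ih.trans (hturn (x, (ρ.rot x ^ n) y))
  have hnode : ∀ x y z, G.Adj x y → G.Adj x z → (ρ.tour T).SameCycle (x, y) (x, z) := by
    intro x y z hy hz
    obtain ⟨n, rfl⟩ := (ρ.isCycleOn x).exists_pow_eq' (Set.toFinite _) hy hz
    exact hpow x y n
  have hwalk : ∀ x x' (_ : T.Walk x x') y y', G.Adj x y → G.Adj x' y' →
      (ρ.tour T).SameCycle (x, y) (x', y') := by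
    intro x x' w
    induction w with
    | nil => exact fun y y' h h' => hnode _ _ _ h h'
    | @cons a b c hab w ih =>
      intro y y' h h'
      refine (hnode a y b h (hT.1 hab)).trans (Perm.SameCycle.trans ?_ (ih a y' (hT.1 hab.symm) h'))
      have h1 : (ρ.tour T).SameCycle (a, b) (b, ρ.rot b a) := ⟨1, by
        rw [zpow_one, ρ.tour_of_adj hab]⟩
      exact h1.trans (hturn (b, a)).symm
  rintro ⟨x, y⟩ hp ⟨x', y'⟩ hp'
  obtain ⟨w⟩ := hT.2.connected x x'
  exact hwalk x x' w y y' hp hp'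

theorem RibbonStructure.tour_pow_eq_iff [Finite N] (ρ : RibbonStructure G) {T : SimpleGraph N}
    (hT : IsSpanningTree G T) {s : N × N} (hs : s ∈ darts G) {i j : ℕ} :
    (ρ.tour T ^ i) s = (ρ.tour T ^ j) s ↔ i ≡ j [MOD (darts G).ncard] := by
  classical
  have hfin := (darts G).toFinite
  have hc := ρ.isCycleOn_tour hT
  rw [← hfin.coe_toFinset] at hc hs
  rw [hc.pow_apply_eq_pow_apply hs, Set.ncard_eq_toFinset_card _ hfin]

theorem RibbonStructure.exists_tour_pow_eq [Finite N] (ρ : RibbonStructure G) {T : SimpleGraph N}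
    (hT : IsSpanningTree G T) {s p : N × N} (hs : s ∈ darts G) (hp : p ∈ darts G) :
    ∃ n < (darts G).ncard, (ρ.tour T ^ n) s = p := by
  classical
  have hfin := (darts G).toFinite
  have hc := ρ.isCycleOn_tour hT
  rw [← hfin.coe_toFinset] at hc hs hp
  rw [Set.ncard_eq_toFinset_card _ hfin]
  exact hc.exists_pow_eq hs hp

theorem RibbonStructure.eq_of_tour_pow_eq [Finite N] (ρ : RibbonStructure G) {T : SimpleGraph N}
    (hT : IsSpanningTree G T) {s : N × N} (hs : s ∈ darts G) {i j : ℕ} (hi : i < (darts G).ncard)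
    (hj : j < (darts G).ncard) (h : (ρ.tour T ^ i) s = (ρ.tour T ^ j) s) : i = j :=
  Nat.ModEq.eq_of_lt_of_lt ((ρ.tour_pow_eq_iff hT hs).mp h) hi hj

/-- Between the two traversals of a tree edge the tour is on one side of it. -/
theorem IsCut.tour_mem [Finite N] (ρ : RibbonStructure G) {T : SimpleGraph N} {S : Set N}
    {y x : N} (h : IsCut T S y x) (hT : IsSpanningTree G T) {s : N × N} (hs : s ∈ darts G)
    {n m i : ℕ} (hn : (ρ.tour T ^ n) s = (x, y)) (hm : (ρ.tour T ^ m) s = (y, x))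
    (hmL : m < (darts G).ncard) (hni : n < i) (him : i ≤ m) : ((ρ.tour T ^ i) s).1 ∈ S := by
  refine h.tour_stays ρ s (i := n + 1) hni ?_ fun k h1 h2 h3 => ?_
  · rw [pow_succ', Perm.mul_apply, hn, ρ.tour_of_adj h.adj.symm]
    exact h.mem
  · have := ρ.eq_of_tour_pow_eq hT hs (by omega) hmL (h3.trans hm.symm)
    omega

/-- The tour is on one side of a tree edge only between the two traversals of that edge. -/
theorem IsCut.of_tour_mem [Finite N] (ρ : RibbonStructure G) {T : SimpleGraph N} {S : Set N}
    {y x : N} (h : IsCut T S y x) (hT : IsSpanningTree G T) {s : N × N} (hs : s ∈ darts G)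
    {n m i : ℕ} (hn : (ρ.tour T ^ n) s = (x, y)) (hm : (ρ.tour T ^ m) s = (y, x)) (hnm : n < m)
    (hmL : m < (darts G).ncard) (hiL : i < (darts G).ncard)
    (hi : ((ρ.tour T ^ i) s).1 ∈ S) : n < i ∧ i ≤ m := by
  constructor
  · by_contra! hle
    have := h.tour_stays ρ s hle hi fun k h1 h2 h3 => by
      have := ρ.eq_of_tour_pow_eq hT hs (by omega) hmL (h3.trans hm.symm)
      omega
    rw [hn] at this
    exact h.not_mem this
  · by_contra! hlt
    refine h.compl.tour_stays ρ s (i := m + 1) hlt ?_ (fun k h1 h2 h3 => ?_) hi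
    · rw [pow_succ', Perm.mul_apply, hm, ρ.tour_of_adj h.adj]
      exact h.not_mem
    · have := ρ.eq_of_tour_pow_eq hT hs (by omega) (by omega) (h3.trans hn.symm)
      omega

/-! ### Jaeger trees and their existence -/

/-- Every edge of `G` outside `T` is first met by the tour around `T` at its endpoint in `B`. -/
def IsJaeger (ρ : RibbonStructure G) (T : SimpleGraph N) (B : Set N) (s : N × N) : Prop :=
  ∀ n, ((ρ.tour T ^ n) s).1 ∉ B → ¬ T.Adj ((ρ.tour T ^ n) s).1 ((ρ.tour T ^ n) s).2 →
    ∃ m < n, (ρ.tour T ^ m) s = ((ρ.tour T ^ n) s).swap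

theorem RibbonStructure.tour_pow_eq (ρ : RibbonStructure G) {T T' : SimpleGraph N} {s : N × N}
    {p : ℕ} (h : ∀ i < p, T.Adj ((ρ.tour T ^ i) s).1 ((ρ.tour T ^ i) s).2 ↔
      T'.Adj ((ρ.tour T ^ i) s).1 ((ρ.tour T ^ i) s).2) :
    ∀ i ≤ p, (ρ.tour T' ^ i) s = (ρ.tour T ^ i) s := by
  intro i
  induction i with
  | zero => intro _; rfl
  | succ i ih =>
    intro hi
    rw [pow_succ', pow_succ', Perm.mul_apply, Perm.mul_apply, ih (by omega)]
    exact (ρ.tour_eq (h i hi)).symm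

open Classical in
/-- The record of the times at which the tour around `T` skips an edge at a node of `B` or traverses
an edge at a node outside `B`. -/
noncomputable def record (ρ : RibbonStructure G) (B : Set N) (s : N × N) (L : ℕ)
    (T : SimpleGraph N) : Lex (Fin L → Bool) :=
  toLex fun i => decide (((ρ.tour T ^ (i : ℕ)) s).1 ∈ B ↔
    ¬ T.Adj ((ρ.tour T ^ (i : ℕ)) s).1 ((ρ.tour T ^ (i : ℕ)) s).2)

/-- The tours coincide up to the first time their trees disagree, so that time alone decides the
lexicographic comparison. -/
theorem record_lt (ρ : RibbonStructure G) {B : Set N} {s : N × N} {L p : ℕ}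
    {T T' : SimpleGraph N} (hp : p < L)
    (h : ∀ i < p, T.Adj ((ρ.tour T ^ i) s).1 ((ρ.tour T ^ i) s).2 ↔
      T'.Adj ((ρ.tour T ^ i) s).1 ((ρ.tour T ^ i) s).2)
    (h1 : ¬ (((ρ.tour T ^ p) s).1 ∈ B ↔ ¬ T.Adj ((ρ.tour T ^ p) s).1 ((ρ.tour T ^ p) s).2))
    (h2 : ((ρ.tour T ^ p) s).1 ∈ B ↔ ¬ T'.Adj ((ρ.tour T ^ p) s).1 ((ρ.tour T ^ p) s).2) :
    record ρ B s L T < record ρ B s L T' := by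
  classical
  have e := ρ.tour_pow_eq h
  refine ⟨⟨p, hp⟩, fun j hj => ?_, ?_⟩
  · have hj : (j : ℕ) < p := hj
    change decide _ = decide _
    simp only [e j hj.le, h j hj]
  · change decide _ < decide _
    simp only [e p le_rfl]
    rw [decide_eq_false h1, decide_eq_true h2]
    decide

theorem exists_isJaeger [Finite N] (ρ : RibbonStructure G) {B : Set N} (hB : Bipartitioned G B)
    {s : N × N} (hs : s ∈ darts G) {T₀ : SimpleGraph N} (hT₀ : IsSpanningTree G T₀) :
    ∃ T, IsSpanningTree G T ∧
      (∀ z ∉ B, (T.neighborSet z).ncard = (T₀.neighborSet z).ncard) ∧ IsJaeger ρ T B s := by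
  obtain ⟨T, ⟨hT, hdeg⟩, hmax⟩ := Set.exists_max_image
    {T | IsSpanningTree G T ∧ ∀ z ∉ B, (T.neighborSet z).ncard = (T₀.neighborSet z).ncard}
    (record ρ B s (darts G).ncard) (Set.toFinite _) ⟨T₀, hT₀, fun _ _ => rfl⟩
  refine ⟨T, hT, hdeg, ?_⟩
  by_contra hJ
  simp only [IsJaeger, not_forall, not_exists, not_and] at hJ
  obtain ⟨n', ha', hnab', hfirst'⟩ := hJ
  -- The record covers a single period only, so the violation is moved into it.
  obtain ⟨n, hnn', hnL, hn⟩ : ∃ n ≤ n', n < (darts G).ncard ∧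
      (ρ.tour T ^ n) s = (ρ.tour T ^ n') s :=
    ⟨n' % (darts G).ncard, Nat.mod_le _ _,
      Nat.mod_lt _ ((Set.ncard_pos (Set.toFinite _)).mpr ⟨s, hs⟩),
      (ρ.tour_pow_eq_iff hT hs).mpr (Nat.mod_modEq _ _)⟩
  have hG := ρ.tour_pow_mem_darts hT.1 hs n'
  obtain ⟨⟨a, b⟩, hab⟩ : ∃ q, (ρ.tour T ^ n') s = q := ⟨_, rfl⟩
  simp only [hab] at ha' hnab' hfirst' hG hn
  have hGab : G.Adj a b := hG
  have hb : b ∈ B := by have := hB a b hGab; tauto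
  obtain ⟨S, c, hcut, hbS⟩ := exists_isCut_of_ne hT.2 hGab.ne
  have hc : c ∈ B := by have := hB c a (hT.1 hcut.adj); tauto
  have hbc : b ≠ c := by rintro rfl; exact hnab' hcut.adj.symm
  have hmem : exchange T a c b ∈
      {T | IsSpanningTree G T ∧ ∀ z ∉ B, (T.neighborSet z).ncard = (T₀.neighborSet z).ncard} := by
    refine ⟨⟨fun u v huv => ?_, hcut.isTree_exchange hT.2 hbS⟩, fun z hz => ?_⟩
    · rcases (exchange_adj hGab.ne).mp huv with h | h
      · exact hT.1 h.1
      · rcases Sym2.eq_iff.mp h with ⟨rfl, rfl⟩ | ⟨rfl, rfl⟩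
        · exact hGab
        · exact hGab.symm
    · rw [ncard_neighborSet_exchange ha' hb hc hcut.adj.symm hnab' hz, hdeg z hz]
  have hle := hmax _ hmem
  classical
  -- Let `p` be the first time that either exchanged edge is met. Meeting `ab` from `a` or `ac` from
  -- `c` raises the record; the other two directions are impossible.
  have hex : ∃ p, s((((ρ.tour T ^ p) s)).1, ((ρ.tour T ^ p) s).2) = s(a, b) ∨
      s((((ρ.tour T ^ p) s)).1, ((ρ.tour T ^ p) s).2) = s(a, c) := ⟨n, by simp [hn]⟩
  obtain ⟨p, hp, hmin⟩ : ∃ p, (s((((ρ.tour T ^ p) s)).1, ((ρ.tour T ^ p) s).2) = s(a, b) ∨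
      s((((ρ.tour T ^ p) s)).1, ((ρ.tour T ^ p) s).2) = s(a, c)) ∧ ∀ i < p,
      ¬ (s((((ρ.tour T ^ i) s)).1, ((ρ.tour T ^ i) s).2) = s(a, b) ∨
      s((((ρ.tour T ^ i) s)).1, ((ρ.tour T ^ i) s).2) = s(a, c)) :=
    ⟨Nat.find hex, Nat.find_spec hex, fun i hi => Nat.find_min hex hi⟩
  have hpn : p ≤ n := by
    by_contra! h
    exact hmin n h (by simp [hn])
  have hagree : ∀ i < p, T.Adj ((ρ.tour T ^ i) s).1 ((ρ.tour T ^ i) s).2 ↔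
      (exchange T a c b).Adj ((ρ.tour T ^ i) s).1 ((ρ.tour T ^ i) s).2 := fun i hi => by
    have := hmin i hi
    rw [exchange_adj hGab.ne]
    tauto
  have hlt := record_lt ρ (B := B) (hpn.trans_lt hnL) hagree
  obtain ⟨⟨u, v⟩, hd⟩ : ∃ q, (ρ.tour T ^ p) s = q := ⟨_, rfl⟩
  simp only [hd] at hp hlt
  rcases hp with hp | hp <;> rcases Sym2.eq_iff.mp hp with ⟨rfl, rfl⟩ | ⟨rfl, rfl⟩
  · refine (hlt ?_ ?_).not_ge hle
    · tauto
    · simp [exchange_adj hGab.ne, ha']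
  · have : p ≠ n := by
      rintro rfl
      rw [hd] at hn
      exact hGab.ne (Prod.ext_iff.mp hn).2
    exact hfirst' p (by omega) hd
  -- The tour enters the side of `b` through `ac` and must meet `ba` before leaving it. The
  -- violating dart at `a` comes no later than `ba`, so it would be met while the tour is on the
  -- side not containing `a`.
  · obtain ⟨m, hmL, hm⟩ := ρ.exists_tour_pow_eq hT hs (p := (v, u)) (hT.1 hcut.adj)
    obtain ⟨j, hjL, hj⟩ := ρ.exists_tour_pow_eq hT hs (p := (b, u)) hGab.symm
    have hpm : p < m := by
      by_contra! h
      rcases h.lt_or_eq with h | rfl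
      · exact hmin m h (by simp [hm, Sym2.eq_swap])
      · rw [hd] at hm
        exact hcut.adj.ne (Prod.ext_iff.mp hm).2
    have hnj : n ≤ j := by
      by_contra! h
      exact hfirst' j (by omega) hj
    have hjm := (hcut.of_tour_mem ρ hT hs hd hm hpm hmL hjL (by rw [hj]; exact hbS)).2
    have hpne : p ≠ n := by
      rintro rfl
      rw [hd] at hn
      exact hbc (Prod.ext_iff.mp hn).2.symm
    have := hcut.tour_mem ρ hT hs hd hm hmL (i := n) (by omega) (by omega)
    rw [hn] at this
    exact hcut.not_mem this
  · refine (hlt ?_ ?_).not_ge hle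
    · simp [hc, hcut.adj]
    · simp only [hc, exchange_adj hGab.ne, true_iff, Sym2.eq_iff]
      grind

/-! ### Reversing the ribbon structure -/

theorem RibbonStructure.tour_reverse (ρ : RibbonStructure G) (T : SimpleGraph N) :
    ρ.reverse.tour T = flip T * (ρ.tour T)⁻¹ * flip T := by
  have : (flip T)⁻¹ = flip T := inv_eq_of_mul_eq_one_left (flip_mul_flip T)
  rw [tour, tour, turn_reverse, mul_inv_rev, this, ← mul_assoc, flip_mul_flip, one_mul]

/-- The exponent `n + 1` reflects the new base edge: `(x, ρ.prev x y)` is the flip of the dart just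
before `(x, y)` on the original tour. -/
theorem RibbonStructure.tour_reverse_pow (ρ : RibbonStructure G) (T : SimpleGraph N) (x y : N)
    (n : ℕ) : (ρ.reverse.tour T ^ n) (x, ρ.prev x y) =
      flip T (((ρ.tour T)⁻¹ ^ (n + 1)) (x, y)) := by
  induction n with
  | zero =>
    have : ρ.turn⁻¹ (x, y) = (x, ρ.prev x y) := by
      rw [Perm.inv_eq_iff_eq, turn_apply, prev, Equiv.apply_symm_apply]
    rw [zero_add, pow_one, pow_zero, tour, mul_inv_rev, Perm.mul_apply, this,
      ← Perm.mul_apply, mul_inv_cancel, Perm.one_apply]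
  | succ n ih =>
    rw [pow_succ', Perm.mul_apply, ih, tour_reverse, Perm.mul_apply, Perm.mul_apply, flip_flip,
      pow_succ' _ (n + 1), Perm.mul_apply]

theorem RibbonStructure.adj_prev (ρ : RibbonStructure G) {x y : N} :
    G.Adj x (ρ.prev x y) ↔ G.Adj x y := by
  rw [← ρ.adj_rot, prev, Equiv.apply_symm_apply]

/-- Turning all cyclic orders opposite exchanges the roles of the two classes of nodes. -/
theorem IsJaeger.reverse [Finite N] {ρ : RibbonStructure G} {T : SimpleGraph N} {B : Set N}
    {x y : N} (hJ : IsJaeger ρ T B (x, y)) (hT : IsSpanningTree G T) (hB : Bipartitioned G B)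
    (hxy : G.Adj x y) : IsJaeger ρ.reverse T Bᶜ (x, ρ.prev x y) := by
  set L := (darts G).ncard with hL
  have hs : (x, y) ∈ darts G := hxy
  have hLpos : 0 < L := (Set.ncard_pos (Set.toFinite _)).mpr ⟨_, hs⟩
  -- Time `k` of the reversed tour matches time `L - 1 - k` of the original; `flip` fixes non-tree
  -- darts, so their order is exactly reversed.
  have hpos : ∀ k < L, (ρ.reverse.tour T ^ k) (x, ρ.prev x y) =
      flip T ((ρ.tour T ^ (L - 1 - k)) (x, y)) := by
    intro k hk
    rw [ρ.tour_reverse_pow, inv_pow]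
    congr 1
    rw [Perm.inv_eq_iff_eq, ← Perm.mul_apply, ← pow_add, show k + 1 + (L - 1 - k) = L by omega]
    exact (ρ.tour_pow_eq_iff hT hs (i := 0)).mpr (by simp [Nat.ModEq, ← hL])
  intro n hn hnT
  obtain ⟨k, hkn, hkL, hk⟩ : ∃ k ≤ n, k < L ∧
      (ρ.reverse.tour T ^ n) (x, ρ.prev x y) = (ρ.reverse.tour T ^ k) (x, ρ.prev x y) :=
    ⟨n % L, Nat.mod_le _ _, Nat.mod_lt _ hLpos,
      (ρ.reverse.tour_pow_eq_iff hT (ρ.adj_prev.mpr hxy)).mpr (Nat.mod_modEq _ _).symm⟩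
  have hd := ρ.reverse.tour_pow_mem_darts hT.1 (p := (x, ρ.prev x y)) (ρ.adj_prev.mpr hxy) n
  rw [hk, hpos k hkL] at hn hnT hd ⊢
  have hnT' : ¬ T.Adj ((ρ.tour T ^ (L - 1 - k)) (x, y)).1 ((ρ.tour T ^ (L - 1 - k)) (x, y)).2 := by
    intro h
    have := flip_of_adj h
    rw [Prod.mk.eta] at this
    rw [this] at hnT
    exact hnT h.symm
  rw [flip_of_not_adj hnT'] at hn hd ⊢
  obtain ⟨⟨b, a⟩, hba⟩ : ∃ q, (ρ.tour T ^ (L - 1 - k)) (x, y) = q := ⟨_, rfl⟩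
  simp only [hba] at hn hnT' hd ⊢
  have hGba : G.Adj b a := hd
  obtain ⟨j, hjL, hj⟩ := ρ.exists_tour_pow_eq hT hs (p := (a, b)) hGba.symm
  have ha : a ∉ B := by have := hB b a hGba; simp only [Set.mem_compl_iff] at hn; tauto
  obtain ⟨m, hmj, hm⟩ := hJ j (by rw [hj]; exact ha) (by rw [hj]; exact fun h => hnT' h.symm)
  rw [hj] at hm
  have := ρ.eq_of_tour_pow_eq hT hs (by omega) (by omega) (hba.trans hm.symm)
  refine ⟨L - 1 - j, by omega, ?_⟩
  rw [hpos _ (by omega), show L - 1 - (L - 1 - j) = j by omega, hj]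
  exact flip_of_not_adj fun h => hnT' h.symm

/-! ### Current graph and traversals along the tour -/

/-- What remains of `G` when the edges outside `T` met at a node of `B` during the first `n` moments
of the tour around `T` have been removed. -/
noncomputable def cutGraph (ρ : RibbonStructure G) (T : SimpleGraph N) (B : Set N) (s : N × N)
    (n : ℕ) : SimpleGraph N :=
  G.deleteEdges {e | e ∉ T.edgeSet ∧ ∃ i < n, ((ρ.tour T ^ i) s).1 ∈ B ∧
    e = s(((ρ.tour T ^ i) s).1, ((ρ.tour T ^ i) s).2)}

/-- The darts of `T` visited during the first `n` moments of the tour. -/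
def traversedBefore (ρ : RibbonStructure G) (T : SimpleGraph N) (s : N × N) (n : ℕ) :
    Set (N × N) :=
  {p | T.Adj p.1 p.2 ∧ ∃ i < n, (ρ.tour T ^ i) s = p}

section

variable {ρ : RibbonStructure G} {T : SimpleGraph N} {B : Set N} {s : N × N} {n n' : ℕ}

theorem cutGraph_adj {u v : N} : (cutGraph ρ T B s n).Adj u v ↔ G.Adj u v ∧ (T.Adj u v ∨
    ∀ i < n, ((ρ.tour T ^ i) s).1 ∈ B →
      s(u, v) ≠ s(((ρ.tour T ^ i) s).1, ((ρ.tour T ^ i) s).2)) := by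
  simp only [cutGraph, deleteEdges_adj, Set.mem_ofPred_eq, mem_edgeSet, not_and, not_exists, ne_eq]
  tauto

theorem le_cutGraph (hT : T ≤ G) : T ≤ cutGraph ρ T B s n :=
  fun _ _ h => cutGraph_adj.mpr ⟨hT h, Or.inl h⟩

theorem cutGraph_le : cutGraph ρ T B s n ≤ G := deleteEdges_le _

theorem cutGraph_zero : cutGraph ρ T B s 0 = G := by
  ext u v
  simp [cutGraph_adj]

/-- In a full period every edge is met from both ends, in particular from its end in `B`. -/
theorem cutGraph_eq_tree [Finite N] (hT : IsSpanningTree G T) (hB : Bipartitioned G B)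
    (hs : s ∈ darts G) (hn : (darts G).ncard ≤ n) : cutGraph ρ T B s n = T := by
  refine le_antisymm (fun u v h => ?_) (le_cutGraph hT.1)
  obtain ⟨hG, h | h⟩ := cutGraph_adj.mp h
  · exact h
  · exfalso
    by_cases hu : u ∈ B
    · obtain ⟨i, hi, hd⟩ := ρ.exists_tour_pow_eq hT hs (p := (u, v)) hG
      exact h i (by omega) (by rw [hd]; exact hu) (by rw [hd])
    · obtain ⟨i, hi, hd⟩ := ρ.exists_tour_pow_eq hT hs (p := (v, u)) hG.symm
      have := hB u v hG
      exact h i (by omega) (by rw [hd]; show v ∈ B; tauto) (by rw [hd]; exact Sym2.eq_swap)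

theorem cutGraph_eq (hnn' : n ≤ n') (h : ∀ i, n ≤ i → i < n' → ((ρ.tour T ^ i) s).1 ∈ B →
    T.Adj ((ρ.tour T ^ i) s).1 ((ρ.tour T ^ i) s).2 ∨
      ¬ (cutGraph ρ T B s n).Adj ((ρ.tour T ^ i) s).1 ((ρ.tour T ^ i) s).2) :
    cutGraph ρ T B s n' = cutGraph ρ T B s n := by
  refine le_antisymm (fun u v huv => ?_) fun u v huv => ?_
  · obtain ⟨h1, h2⟩ := cutGraph_adj.mp huv
    exact cutGraph_adj.mpr ⟨h1, h2.imp_right fun h2 i hi => h2 i (by omega)⟩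
  · obtain ⟨h1, h2⟩ := cutGraph_adj.mp huv
    refine cutGraph_adj.mpr ⟨h1, or_iff_not_imp_left.mpr fun hTuv i hi hiB he => ?_⟩
    by_cases hin : i < n
    · exact h2.resolve_left hTuv i hin hiB he
    · rw [← mem_edgeSet, he, mem_edgeSet] at hTuv
      rw [← mem_edgeSet, he, mem_edgeSet] at huv
      rcases h i (by omega) hi hiB with h' | h'
      · exact hTuv h'
      · exact h' huv

theorem cutGraph_succ {x y : N} (hd : (ρ.tour T ^ n) s = (x, y)) (hx : x ∈ B)
    (hxy : ¬ T.Adj x y) :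
    cutGraph ρ T B s (n + 1) = (cutGraph ρ T B s n).deleteEdges {s(x, y)} := by
  ext u v
  rw [deleteEdges_adj, cutGraph_adj, cutGraph_adj, Set.mem_singleton_iff]
  constructor
  · rintro ⟨h1, h2⟩
    refine ⟨⟨h1, h2.imp_right fun h2 i hi => h2 i (by omega)⟩, fun he => ?_⟩
    rcases h2 with h2 | h2
    · rw [← mem_edgeSet, he, mem_edgeSet] at h2
      exact hxy h2
    · exact h2 n (by omega) (by rw [hd]; exact hx) (by rw [hd]; exact he)
  · rintro ⟨⟨h1, h2⟩, h3⟩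
    refine ⟨h1, h2.imp_right fun h2 i hi hiB he => ?_⟩
    rcases Nat.lt_succ_iff_lt_or_eq.mp hi with hi | rfl
    · exact h2 i hi hiB he
    · rw [hd] at he
      exact h3 he

theorem traversedBefore_eq (hnn' : n ≤ n') (h : ∀ i, n ≤ i → i < n' →
    ¬ T.Adj ((ρ.tour T ^ i) s).1 ((ρ.tour T ^ i) s).2) :
    traversedBefore ρ T s n' = traversedBefore ρ T s n := by
  ext p
  refine and_congr_right fun hp => ⟨?_, fun ⟨i, hi, hd⟩ => ⟨i, by omega, hd⟩⟩
  rintro ⟨i, hi, rfl⟩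
  by_cases hin : i < n
  · exact ⟨i, hin, rfl⟩
  · exact absurd hp (h i (by omega) hi)

theorem traversedBefore_succ {p : N × N} (hd : (ρ.tour T ^ n) s = p) (hp : T.Adj p.1 p.2) :
    traversedBefore ρ T s (n + 1) = insert p (traversedBefore ρ T s n) := by
  ext q
  simp only [traversedBefore, Set.mem_ofPred_eq, Set.mem_insert_iff, Nat.lt_succ_iff_lt_or_eq]
  constructor
  · rintro ⟨h, i, hi | rfl, rfl⟩
    · exact Or.inr ⟨h, i, hi, rfl⟩
    · exact Or.inl hd
  · rintro (rfl | ⟨h, i, hi, rfl⟩)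
    · exact ⟨hp, n, Or.inr rfl, hd⟩
    · exact ⟨h, i, Or.inl hi, rfl⟩

theorem le_of_mem_traversedBefore [Finite N] (hT : IsSpanningTree G T) (hs : s ∈ darts G)
    (h : (ρ.tour T ^ n') s ∈ traversedBefore ρ T s n) (hnn' : n ≤ n') : (darts G).ncard ≤ n' := by
  obtain ⟨-, i, hi, hd⟩ := h
  by_contra! hlt
  have := ρ.eq_of_tour_pow_eq hT hs (by omega) hlt hd
  omega

/-- The tour turning around a node without traversing an edge. -/
theorem tour_pow_add {x z : N} {k : ℕ} (hd : (ρ.tour T ^ n) s = (x, z))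
    (h : ∀ i < k, ¬ T.Adj x ((ρ.rot x ^ i) z)) :
    ∀ i ≤ k, (ρ.tour T ^ (n + i)) s = (x, (ρ.rot x ^ i) z) := by
  intro i
  induction i with
  | zero => intro _; exact hd
  | succ i ih =>
    intro hi
    rw [← add_assoc, pow_succ', Perm.mul_apply, ih (by omega), ρ.tour_of_not_adj (h i (by omega)),
      pow_succ', Perm.mul_apply]

theorem tour_pow_add_of_adj {x y : N} {k : ℕ} (hd : (ρ.tour T ^ n) s = (x, y)) (hxy : T.Adj x y)
    (h : ∀ i, 0 < i → i < k → ¬ T.Adj y ((ρ.rot y ^ i) x)) :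
    ∀ i, 0 < i → i ≤ k → (ρ.tour T ^ (n + i)) s = (y, (ρ.rot y ^ i) x) := by
  intro i hi0 hik
  have h1 : (ρ.tour T ^ (n + 1)) s = (y, ρ.rot y x) := by
    rw [pow_succ', Perm.mul_apply, hd, ρ.tour_of_adj hxy]
  have := tour_pow_add (k := k - 1) h1 (fun j hj => by
    have := h (j + 1) (by omega) (by omega)
    rwa [pow_succ, Perm.mul_apply] at this) (i - 1) (by omega)
  rw [← Perm.mul_apply, ← pow_succ, show i - 1 + 1 = i by omega,
    show n + 1 + (i - 1) = n + i by omega] at this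
  exact this

/-- The order of the rotation returns to `y`, so the infimum defining `nextIn` is attained and is
not the default value `0`. -/
theorem exists_nextIn_eq [Finite N] {K : SimpleGraph N} {x y : N} (h : K.Adj x y) :
    ∃ k, 0 < k ∧ ρ.nextIn K x y = (ρ.rot x ^ k) y ∧ K.Adj x (ρ.nextIn K x y) ∧
      ∀ i, 0 < i → i < k → ¬ K.Adj x ((ρ.rot x ^ i) y) := by
  have hne : {k : ℕ | 0 < k ∧ K.Adj x ((ρ.rot x ^ k) y)}.Nonempty :=
    ⟨orderOf (ρ.rot x), orderOf_pos _, by rwa [pow_orderOf_eq_one]⟩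
  have hmem := Nat.sInf_mem hne
  exact ⟨_, hmem.1, rfl, hmem.2, fun i h0 hi hK => Nat.notMem_of_lt_sInf hi ⟨h0, hK⟩⟩

/-- The rotation is a single cycle on the neighbours of `x`, so it meets `w` before it returns to
`y`. -/
theorem nextIn_ne [Finite N] {K : SimpleGraph N} (hK : K ≤ G) {x y w : N} (hy : K.Adj x y)
    (hw : K.Adj x w) (hwy : w ≠ y) : ρ.nextIn K x y ≠ y := by
  classical
  obtain ⟨k, hk0, hk, -, hmin⟩ := exists_nextIn_eq (ρ := ρ) hy
  have hex : ∃ j, (ρ.rot x ^ j) y = w :=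
    (ρ.isCycleOn x).exists_pow_eq' (Set.toFinite _) (hK hy) (hK hw)
  obtain ⟨j, hj, hjmin⟩ : ∃ j, (ρ.rot x ^ j) y = w ∧ ∀ i < j, (ρ.rot x ^ i) y ≠ w :=
    ⟨Nat.find hex, Nat.find_spec hex, fun i hi => Nat.find_min hex hi⟩
  have hj0 : 0 < j := by
    rw [Nat.pos_iff_ne_zero]
    rintro rfl
    exact hwy hj.symm
  intro hk'
  rw [hk] at hk'
  by_cases hlt : j < k
  · exact hmin _ hj0 hlt (hj.symm ▸ hw)
  · refine hjmin (j - k) (by omega) ?_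
    conv_lhs => rw [← hk', ← Perm.mul_apply, ← pow_add, Nat.sub_add_cancel (by omega)]
    exact hj

/-! ### The walk follows the tour -/

/-- The edges of a Jaeger tree cannot be removed when the tour arrives at them from `B`. -/
theorem IsJaeger.not_realizable [Finite N] (hJ : IsJaeger ρ T B s) (hT : IsSpanningTree G T)
    (hB : Bipartitioned G B) (hs : s ∈ darts G) {x y : N} (hd : (ρ.tour T ^ n) s = (x, y))
    (hx : x ∈ B) (hxy : T.Adj x y) {T' : SimpleGraph N}
    (hT' : IsSpanningTree ((cutGraph ρ T B s n).deleteEdges {s(x, y)}) T')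
    (hdeg : ∀ z ∉ B, (T'.neighborSet z).ncard = (T.neighborSet z).ncard) : False := by
  have hcut := isCut_side hT.2.isAcyclic hxy.symm
  have hT'G : T' ≤ G := hT'.1.trans ((deleteEdges_le _).trans cutGraph_le)
  have hy : y ∉ B := (hB x y (hT.1 hxy)).mp hx
  refine hcut.false_of_ncard_eq hT.2 hT'.2.isAcyclic (hB.mono hT.1) (hB.mono hT'G) hy hdeg
    fun u v hu huB huv => ?_
  -- A `T'`-edge `uv` leaving the side of `y` at `u` off `B` is not in `T`, so the tour meets it
  -- first at `v`, and after time `n` since it is not yet cut. The times spent on either side of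
  -- `xy` exclude this order.
  by_contra hv
  have huv' := hT'.1 huv
  rw [deleteEdges_adj, Set.mem_singleton_iff] at huv'
  have hTuv : ¬ T.Adj u v := fun h => by
    obtain ⟨rfl, rfl⟩ := hcut.eq_of_adj u v hu hv h
    exact huv'.2 Sym2.eq_swap
  by_cases hnL : (darts G).ncard ≤ n
  · rw [cutGraph_eq_tree hT hB hs hnL] at huv'
    exact hTuv huv'.1
  have hG : G.Adj u v := hT'G huv
  have hvB : v ∈ B := by have := hB u v hG; tauto
  obtain ⟨m, hmL, hm⟩ := ρ.exists_tour_pow_eq hT hs (p := (y, x)) (hT.1 hxy.symm)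
  obtain ⟨j, hjL, hj⟩ := ρ.exists_tour_pow_eq hT hs (p := (u, v)) hG
  obtain ⟨i, hij, hi⟩ := hJ j (by rw [hj]; exact huB) (by rw [hj]; exact hTuv)
  rw [hj, Prod.swap_prod_mk] at hi
  have hni : n ≤ i := by
    by_contra! h
    refine (cutGraph_adj.mp huv'.1).2.resolve_left hTuv i h (by rw [hi]; exact hvB) ?_
    rw [hi]
    exact Sym2.eq_swap
  have hne : n ≠ i := by
    rintro rfl
    rw [hd] at hi
    obtain ⟨rfl, rfl⟩ := Prod.ext_iff.mp hi
    exact hTuv hxy.symm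
  have hmn : m ≠ n := by
    rintro rfl
    rw [hd] at hm
    exact hxy.ne (Prod.ext_iff.mp hm).1
  rcases hmn.lt_or_gt with h | h
  · have := (hcut.compl.of_tour_mem ρ hT hs hm hd h (by omega) (i := i) (by omega)
      (by rw [hi]; exact hv)).2
    omega
  · have h1 := (hcut.of_tour_mem ρ hT hs hd hm h hmL hjL (by rw [hj]; exact hu)).2
    have := hcut.tour_mem ρ hT hs hd hm hmL (i := i) (by omega) (by omega)
    rw [hi] at this
    exact hv this

variable (ρ T B s n) in
/-- The walk is at moment `n` of the tour around `T`. -/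
structure IsAt (st : WalkState N) : Prop where
  graph : st.graph = cutGraph ρ T B s n
  dart : (ρ.tour T ^ n) s = (st.node, st.nbr)
  node_mem : st.node ∈ B
  adj : (cutGraph ρ T B s n).Adj st.node st.nbr
  traversed : st.traversed = traversedBefore ρ T s n

theorem IsAt.step_cut [Finite N] {st : WalkState N} (h : IsAt ρ T B s n st)
    (hT : IsSpanningTree G T) (hxy : ¬ T.Adj st.node st.nbr) :
    ∃ n' > n, IsAt ρ T B s n' ⟨st.graph.deleteEdges {s(st.node, st.nbr)}, st.node,
      ρ.nextIn st.graph st.node st.nbr, st.traversed⟩ := by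
  obtain ⟨K, x, y, R⟩ := st
  obtain ⟨hK, hd, hx, hadj, hR⟩ := h
  dsimp only at hK hd hx hadj hR hxy ⊢
  subst hK hR
  obtain ⟨k, hk0, hk, hkadj, hmin⟩ := exists_nextIn_eq (ρ := ρ) hadj
  have hchain : ∀ i < k, ¬ T.Adj x ((ρ.rot x ^ i) y) := fun i hi hTi => by
    rcases Nat.eq_zero_or_pos i with rfl | hi0
    · exact hxy hTi
    · exact hmin i hi0 hi (le_cutGraph hT.1 hTi)
  have hpos := tour_pow_add hd hchain
  have hKeq : cutGraph ρ T B s (n + k) = (cutGraph ρ T B s n).deleteEdges {s(x, y)} := by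
    rw [← cutGraph_succ hd hx hxy]
    refine cutGraph_eq (by omega) fun i h1 h2 _ => Or.inr ?_
    rw [cutGraph_succ hd hx hxy, show i = n + (i - n) by omega, hpos _ (by omega)]
    exact fun h => hmin (i - n) (by omega) (by omega) (deleteEdges_le _ h)
  refine ⟨n + k, by omega, hKeq.symm, ?_, hx, ?_, ?_⟩
  · rw [hpos k le_rfl, hk]
  · rw [hKeq, deleteEdges_adj, Set.mem_singleton_iff]
    -- The next edge is taken in the graph before the cut; it differs from the cut edge because `x`
    -- also has a tree edge.
    refine ⟨hkadj, fun he => ?_⟩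
    have : Nontrivial N := ⟨x, y, hadj.ne⟩
    obtain ⟨w, hw⟩ := hT.2.connected.preconnected.exists_adj_of_nontrivial x
    refine nextIn_ne (ρ := ρ) cutGraph_le hadj (le_cutGraph hT.1 hw)
      (fun e => hxy (e ▸ hw)) ?_
    rcases Sym2.eq_iff.mp he with h | h
    · exact h.2
    · exact absurd h.1 hadj.ne
  · refine (traversedBefore_eq (by omega) fun i h1 h2 => ?_).symm
    rw [show i = n + (i - n) by omega, hpos _ (by omega)]
    exact hchain _ (by omega)

theorem IsAt.step_traverse [Finite N] {st : WalkState N} (h : IsAt ρ T B s n st)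
    (hT : IsSpanningTree G T) (hB : Bipartitioned G B) (hs : s ∈ darts G)
    (hJ : IsJaeger ρ T B s) (hxy : T.Adj st.node st.nbr) :
    (((st.node, st.nbr) ∈ st.traversed ∨
      (st.nbr, ρ.nextIn st.graph st.nbr st.node) ∈ st.traversed) → st.graph = T) ∧
    (n < (darts G).ncard ∨ (st.node, st.nbr) ∈ st.traversed) ∧
    ∃ n' > n, IsAt ρ T B s n' ⟨st.graph, ρ.nextIn st.graph st.nbr st.node,
      ρ.nextIn st.graph (ρ.nextIn st.graph st.nbr st.node) st.nbr,
      st.traversed ∪ {(st.node, st.nbr), (st.nbr, ρ.nextIn st.graph st.nbr st.node)}⟩ := by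
  obtain ⟨K, x, y, R⟩ := st
  obtain ⟨hK, hd, hx, hadj, hR⟩ := h
  dsimp only at hK hd hx hadj hR hxy ⊢
  subst hK hR
  have hy : y ∉ B := (hB x y (hT.1 hxy)).mp hx
  obtain ⟨k, hk0, hk, hkadj, hmin⟩ := exists_nextIn_eq (ρ := ρ) hadj.symm
  set z := ρ.nextIn (cutGraph ρ T B s n) y x with hz
  have hchain : ∀ i, 0 < i → i < k → ¬ T.Adj y ((ρ.rot y ^ i) x) :=
    fun i h0 hi h => hmin i h0 hi (le_cutGraph hT.1 h)
  have hpos := tour_pow_add_of_adj hd hxy hchain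
  have hdk : (ρ.tour T ^ (n + k)) s = (y, z) := by rw [hpos k hk0 le_rfl, hk]
  have hKeq : cutGraph ρ T B s (n + k) = cutGraph ρ T B s n := by
    refine cutGraph_eq (by omega) fun i h1 h2 _ => ?_
    rcases h1.eq_or_lt with rfl | h1
    · left
      rw [hd]
      exact hxy
    · right
      rw [show i = n + (i - n) by omega, hpos _ (by omega) (by omega)]
      exact hmin _ (by omega) (by omega)
  -- If `yz` were not in `T`, it would have been met earlier at `z`. Before time `n` this would have
  -- cut it; at time `n` it would be the tree edge `xy`; after that the tour is at `y`.
  have hyz : T.Adj y z := by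
    by_contra hyz
    have hzB : z ∈ B := by have := hB y z (cutGraph_le hkadj); tauto
    obtain ⟨m, hm, hdm⟩ := hJ (n + k) (by rw [hdk]; exact hy) (by rw [hdk]; exact hyz)
    rw [hdk, Prod.swap_prod_mk] at hdm
    rcases lt_trichotomy m n with hmn | rfl | hmn
    · refine (cutGraph_adj.mp hkadj).2.resolve_left hyz m hmn (by rw [hdm]; exact hzB) ?_
      rw [hdm]
      exact Sym2.eq_swap
    · rw [hd] at hdm
      have hxz : x = z := (Prod.ext_iff.mp hdm).1
      exact hyz (hxz ▸ hxy.symm)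
    · rw [show m = n + (m - n) by omega, hpos _ (by omega) (by omega)] at hdm
      exact hkadj.ne (Prod.ext_iff.mp hdm).1
  obtain ⟨k', hk0', hk', hkadj', hmin'⟩ := exists_nextIn_eq (ρ := ρ) hkadj.symm
  have hchain' : ∀ i, 0 < i → i < k' → ¬ T.Adj z ((ρ.rot z ^ i) y) :=
    fun i h0 hi h => hmin' i h0 hi (le_cutGraph hT.1 h)
  have hpos' := tour_pow_add_of_adj hdk hyz hchain'
  have hKeq' : cutGraph ρ T B s (n + k + k') = cutGraph ρ T B s n := by
    rw [← hKeq]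
    refine cutGraph_eq (by omega) fun i h1 h2 _ => ?_
    rcases h1.eq_or_lt with rfl | h1
    · left
      rw [hdk]
      exact hyz
    · right
      rw [show i = n + k + (i - (n + k)) by omega, hpos' _ (by omega) (by omega), hKeq]
      exact hmin' _ (by omega) (by omega)
  -- A dart repeats only after a full period, when the current graph has shrunk to `T`; conversely,
  -- after a full period the current dart has already been traversed.
  refine ⟨?_, ?_, n + k + k', by omega, hKeq'.symm, ?_, ?_, ?_, ?_⟩
  · rintro (h | h)
    · rw [← hd] at h
      exact cutGraph_eq_tree hT hB hs (le_of_mem_traversedBefore hT hs h le_rfl)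
    · rw [← hdk] at h
      rw [← hKeq]
      exact cutGraph_eq_tree hT hB hs (le_of_mem_traversedBefore hT hs h (by omega))
  · refine or_iff_not_imp_left.mpr fun hn => ⟨hxy, ?_⟩
    obtain ⟨i, hi, h⟩ := ρ.exists_tour_pow_eq hT hs (p := (x, y)) (hT.1 hxy)
    exact ⟨i, by omega, h⟩
  · rw [hpos' k' hk0' le_rfl, hk']
  · have := hB y z (cutGraph_le hkadj)
    show z ∈ B
    tauto
  · rw [hKeq']
    exact hkadj'
  · symm
    rw [traversedBefore_eq (n := n + k + 1) (by omega) fun i h1 h2 => by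
        rw [show i = n + k + (i - (n + k)) by omega, hpos' _ (by omega) (by omega)]
        exact hchain' _ (by omega) (by omega),
      traversedBefore_succ hdk hyz, traversedBefore_eq (n := n + 1) (by omega) fun i h1 h2 => by
        rw [show i = n + (i - n) by omega, hpos _ (by omega) (by omega)]
        exact hchain _ (by omega) (by omega), traversedBefore_succ hd hxy]
    ext p
    simp only [Set.mem_union, Set.mem_insert_iff, Set.mem_singleton_iff]
    tauto

end

/-- The walk run on the degrees of a Jaeger tree follows the tour around it. -/
theorem IsJaeger.exists_reflTransGen [Finite N] {A : Type w} {ι : A → N} {f : A → ℕ}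
    {ρ : RibbonStructure G} {T : SimpleGraph N} {B : Set N} {s : N × N}
    (hJ : IsJaeger ρ T B s) (hT : IsSpanningTree G T) (hB : Bipartitioned G B) (hs : s ∈ darts G)
    (hι : Set.range ι = Bᶜ) (hf : ∀ a, (T.neighborSet (ι a)).ncard = f a + 1) (n : ℕ)
    (st : WalkState N) (h : IsAt ρ T B s n st) :
    ∃ st' : WalkState N, Relation.ReflTransGen (fun a b => step ρ ι f a = some b) st st' ∧
      step ρ ι f st' = none ∧ st'.graph = T := by
  induction hr : (darts G).ncard - n using Nat.strong_induction_on generalizing n st with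
  | _ r ih =>
    have next : ∀ n' st', n < (darts G).ncard → n < n' → step ρ ι f st = some st' →
        IsAt ρ T B s n' st' → ∃ st' : WalkState N,
          Relation.ReflTransGen (fun a b => step ρ ι f a = some b) st st' ∧
          step ρ ι f st' = none ∧ st'.graph = T := by
      intro n' st' hn hn' hst hat
      obtain ⟨st'', h1, h2⟩ := ih _ (by omega) n' st' hat rfl
      exact ⟨st'', Relation.ReflTransGen.head hst h1, h2⟩
    by_cases hxy : T.Adj st.node st.nbr
    · have hnot : ¬ IsHypertree (st.graph.deleteEdges {s(st.node, st.nbr)}) ι f := by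
        rintro ⟨T', hT', hdeg⟩
        rw [h.graph] at hT'
        refine hJ.not_realizable hT hB hs h.dart h.node_mem hxy hT' fun z hz => ?_
        obtain ⟨a, rfl⟩ : z ∈ Set.range ι := hι ▸ hz
        rw [hdeg, hf]
      obtain ⟨h1, h2, n', hn', hat⟩ := h.step_traverse hT hB hs hJ hxy
      by_cases htrav : (st.node, st.nbr) ∈ st.traversed ∨
          (st.nbr, ρ.nextIn st.graph st.nbr st.node) ∈ st.traversed
      · refine ⟨st, Relation.ReflTransGen.refl, ?_, h1 htrav⟩
        rw [step, if_neg hnot, if_pos htrav]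
      · refine next n' _ (h2.resolve_right fun h => htrav (Or.inl h)) hn' ?_ hat
        rw [step, if_neg hnot, if_neg htrav]
    · have hyes : IsHypertree (st.graph.deleteEdges {s(st.node, st.nbr)}) ι f := by
        refine ⟨T, ⟨fun u v huv => ?_, hT.2⟩, hf⟩
        rw [h.graph, deleteEdges_adj, Set.mem_singleton_iff]
        refine ⟨le_cutGraph hT.1 huv, fun he => ?_⟩
        rw [← mem_edgeSet, he, mem_edgeSet] at huv
        exact hxy huv
      obtain ⟨n', hn', hat⟩ := h.step_cut hT hxy
      refine next n' _ ?_ hn' ?_ hat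
      · by_contra! hn
        have := h.adj
        rw [cutGraph_eq_tree hT hB hs hn] at this
        exact hxy this
      · rw [step, if_pos hyes]

theorem IsJaeger.yields [Finite N] {A : Type w} {ι : A → N} {f : A → ℕ}
    {ρ : RibbonStructure G} {T : SimpleGraph N} {B : Set N} {b₀ b₁ : N}
    (hJ : IsJaeger ρ T B (b₀, b₁)) (hT : IsSpanningTree G T) (hB : Bipartitioned G B)
    (hb : G.Adj b₀ b₁) (hι : Set.range ι = Bᶜ)
    (hf : ∀ a, (T.neighborSet (ι a)).ncard = f a + 1) : Yields ρ ι B b₀ b₁ f T := by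
  have run := hJ.exists_reflTransGen hT hB hb hι hf
  by_cases h₀ : b₀ ∈ B
  · refine run 0 _ ?_
    rw [initState, if_pos h₀]
    refine ⟨cutGraph_zero.symm, rfl, h₀, by rwa [cutGraph_zero], ?_⟩
    simp [traversedBefore]
  -- Nothing precedes time `0`, so the Jaeger condition forces the base edge into `T`; the walk then
  -- starts at moment `1` of the tour.
  · have hTb : T.Adj b₀ b₁ := by
      by_contra hTb
      obtain ⟨m, hm, -⟩ := hJ 0 h₀ hTb
      omega
    have hd : (ρ.tour T ^ 0) (b₀, b₁) = (b₀, b₁) := rfl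
    have hK : cutGraph ρ T B (b₀, b₁) 1 = G := by
      rw [cutGraph_eq (n := 0) (by omega), cutGraph_zero]
      intro i _ hi hiB
      obtain rfl : i = 0 := by omega
      exact absurd hiB h₀
    have hadj : G.Adj b₁ (ρ.rot b₁ b₀) := ρ.adj_rot.mpr hb.symm
    have hnext : ρ.nextIn G b₁ b₀ = ρ.rot b₁ b₀ := by
      obtain ⟨k, hk0, hk, -, hmin⟩ := exists_nextIn_eq (ρ := ρ) hb.symm
      obtain rfl : k = 1 := by
        by_contra hk1
        exact hmin 1 one_pos (by omega) (by rwa [pow_one])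
      rw [hk, pow_one]
    refine run 1 _ ?_
    rw [initState, if_neg h₀, hnext]
    refine ⟨hK.symm, ?_, ?_, by rwa [hK], ?_⟩
    · rw [pow_one, ρ.tour_of_adj hTb]
    · have := hB b₀ b₁ hb
      show b₁ ∈ B
      tauto
    · rw [traversedBefore_succ (n := 0) hd hTb]
      ext p
      simp [traversedBefore]

/-- `step` is a function, so of two runs from one initial state one extends the other, and a stopped
state has no successor. -/
theorem Yields.unique {A : Type w} {ι : A → N} {f : A → ℕ} {ρ : RibbonStructure G}
    {T T' : SimpleGraph N} {B : Set N} {b₀ b₁ : N} (h : Yields ρ ι B b₀ b₁ f T)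
    (h' : Yields ρ ι B b₀ b₁ f T') : T = T' := by
  obtain ⟨st, h1, h2, rfl⟩ := h
  obtain ⟨st', h1', h2', rfl⟩ := h'
  have final : ∀ {a b : WalkState N}, step ρ ι f a = none →
      Relation.ReflTransGen (fun a b => step ρ ι f a = some b) a b → a = b := by
    intro a b ha hab
    rcases Relation.ReflTransGen.cases_head hab with h | ⟨c, hc, -⟩
    · exact h
    · rw [ha] at hc
      cases hc
  have huniq : Relator.RightUnique (fun a b => step ρ ι f a = some b) :=
    fun a b c hb hc => Option.some.inj (hb.symm.trans hc)
  rcases Relation.ReflTransGen.total_of_right_unique huniq h1 h1' with h | h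
  · rw [final h2 h]
  · rw [final h2' h]

/-! ### Conclusion for hypergraphs -/

theorem MultiHypergraph.bipartitioned_bip {V : Type u} {E : Type w} (H : MultiHypergraph V E) :
    Bipartitioned H.bip (Set.range Sum.inl) := by
  rintro x y (⟨v, e, -, rfl, rfl⟩ | ⟨v, e, -, rfl, rfl⟩) <;> simp

end Bernardi

theorem mainTheorem11 {V : Type*} {E : Type*} [Finite V] [Finite E]
    (H : Bernardi.MultiHypergraph V E) (hconn : H.bip.Connected)
    (ρ : Bernardi.RibbonStructure H.bip) (b₀ b₁ : V ⊕ E) (hb : H.bip.Adj b₀ b₁)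
    (f : E → ℕ) (hf : Bernardi.IsHypertree H.bip Sum.inr f) :
    (∃ T : SimpleGraph (V ⊕ E), Bernardi.YieldsHtECutV ρ b₀ b₁ f T) ∧
    ∀ T : SimpleGraph (V ⊕ E), Bernardi.YieldsHtECutV ρ b₀ b₁ f T →
      Bernardi.IsSpanningTree H.bip T ∧
      Bernardi.IsHypertree H.bip Sum.inl (Bernardi.induced Sum.inl T) ∧
      Bernardi.YieldsHtVCutE ρ.reverse b₀ (ρ.prev b₀ b₁) (Bernardi.induced Sum.inl T) T := by
  have hB := H.bipartitioned_bip
  obtain ⟨T₀, hT₀, hf₀⟩ := hf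
  obtain ⟨T, hT, hdeg, hJ⟩ := Bernardi.exists_isJaeger ρ hB (s := (b₀, b₁)) hb hT₀
  have hrange : Set.range (Sum.inr : E → V ⊕ E) = (Set.range Sum.inl)ᶜ :=
    Set.isCompl_range_inl_range_inr.symm.eq_compl
  have hy : Bernardi.YieldsHtECutV ρ b₀ b₁ f T :=
    hJ.yields hT hB hb hrange fun e => by rw [hdeg _ (by simp), hf₀]
  refine ⟨⟨T, hy⟩, fun T' hT' => ?_⟩
  obtain rfl := Bernardi.Yields.unique hy hT'
  -- Tree degrees are positive here, so the truncated subtraction in `induced` loses nothing.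
  have hpos : ∀ v, (T.neighborSet (Sum.inl v)).ncard = Bernardi.induced Sum.inl T v + 1 := by
    intro v
    have : Nontrivial (V ⊕ E) := ⟨b₀, b₁, hb.ne⟩
    obtain ⟨w, hw⟩ := hT.2.connected.preconnected.exists_adj_of_nontrivial (Sum.inl v)
    have := (Set.ncard_pos (Set.toFinite _)).mpr ⟨w, (T.mem_neighborSet _ _).mpr hw⟩
    rw [Bernardi.induced]
    omega
  refine ⟨hT, ⟨T, hT, hpos⟩, ?_⟩
  have hJ' := hJ.reverse hT hB hb
  have hB' := hB.compl
  rw [← hrange] at hJ' hB'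
  exact hJ'.yields hT hB' (ρ.adj_prev.mpr hb)
    (by rw [hrange, compl_compl]) hpos
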